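/- Let $\&$ be a continuous t-norm on $[0,1]$, that is, a continuous, commutative, associative operation $[0,1]^2\to[0,1]$, order-preserving in each variable, with unit $1$; let $x\to y=\max\{z\in[0,1] : x\& z\le y\}$ be its implication. A real-enriched category is a set $X$ with a map $X(-,-)\colon X\times X\to[0,1]$ such that $X(x,x)=1$ and $X(y,z)\& X(x,y)\le X(x,z)$ for all $x,y,z$; its opposite is $X^{\rm op}(x,y)=X(y,x)$. A functor $f\colon X\to Y$ is a map with $X(x,y)\le Y(f(x),f(y))$; a functor $f\colon X\to Y$ is left adjoint to a functor $g\colon Y\to X$ if $Y(f(x),y)=X(x,g(y))$ for all $x\in X$, $y\in Y$. A weight of $X$ is a map $\phi\colon X\to[0,1]$ with $\phi(y)\& X(x,y)\le\phi(x)$ for all $x,y$; the weights of $X$ form a real-enriched category $\mathcal PX$ with $\mathcal PX(\phi,\psi)=\inf_{x\in X}(\phi(x)\to\psi(x))$, and ${\sf y}_X\colon X\to\mathcal PX$, $a\mapsto X(-,a)$, is the Yoneda embedding. For a functor $f\colon X\to Y$, the functor $\mathcal Pf\colon\mathcal PX\to\mathcal PY$ sends $\phi$ to $y\mapsto\sup_{x\in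 X}\phi(x)\& Y(y,f(x))$, and ${\sf m}_X\colon\mathcal P\mathcal PX\to\mathcal PX$ sends $\Phi$ to its colimit $x\mapsto\sup_{\phi\in\mathcal PX}\Phi(\phi)\&\mathcal PX({\sf y}_X(x),\phi)$; $\mathbb P=(\mathcal P,{\sf m},{\sf y})$ is the presheaf monad. A $\mathbb P$-algebra is an (Eilenberg–Moore) algebra of this monad, and a real-enriched category $A$ is completely distributive if it is a continuous $\mathbb P$-algebra, that is, $A$ carries the structure of a $\mathbb P$-algebra and the left adjoint $\operatorname{colim}\colon\mathcal PA\to A$ of ${\sf y}_A$ itself has a left adjoint. Write ${\sf V}=([0,1],\alpha_L)$ with $\alpha_L(x,y)=x\to y$, so that ${\sf V}^{\rm op}=([0,1],\alpha_R)$ with $\alpha_R(x,y)=y\to x$. Then the following are equivalent: 1. The t-norm $\&$ is isomorphic to the Łukasiewicz t-norm $(x,y)\mapsto\max\{x+y-1,0\}$, i.e. some order-preserving bijection of $[0,1]$ carries one operation to the other. 2. If a real-enriched category $X$ is completely distributive, then so is $X^{\rm op}$. 3. The real-enriched category ${\sf V}^{\rm op}$ is completely distributive. -/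

import Mathlib

open unitInterval

universe u v

namespace RealEnriched

/-- A triangular norm on `[0,1]`. -/
structure TNorm where
  mul : I → I → I
  mul_comm : ∀ x y, mul x y = mul y x
  mul_assoc : ∀ x y z, mul (mul x y) z = mul x (mul y z)
  mul_mono : ∀ x y z, y ≤ z → mul x y ≤ mul x z
  mul_one : ∀ x, mul x 1 = x

/-- Two t-norms on `[0,1]` are isomorphic if some order-preserving bijection intertwines them. -/
def TNorm.Isomorphic (S T : TNorm) : Prop :=
  ∃ f : I ≃o I, ∀ x y, f (S.mul x y) = T.mul (f x) (f y)

/-- The Łukasiewicz t-norm `max (x + y - 1) 0`. -/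
noncomputable def lukasiewicz : TNorm where
  mul x y := ⟨max ((x : ℝ) + y - 1) 0, le_max_right _ _, by
    have hx := x.2.2
    have hy := y.2.2
    exact max_le (by linarith) zero_le_one⟩
  mul_comm x y := by
    apply Subtype.ext
    simp only [add_comm]
  mul_assoc x y z := by
    apply Subtype.ext
    have hx := x.2.2
    have hz := z.2.2
    change max (max ((x : ℝ) + y - 1) 0 + z - 1) 0 = max ((x : ℝ) + max ((y : ℝ) + z - 1) 0 - 1) 0
    rcases le_total ((x : ℝ) + y - 1) 0 with h1 | h1 <;>
    rcases le_total ((y : ℝ) + z - 1) 0 with h2 | h2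
    · rw [max_eq_right h1, max_eq_right h2, max_eq_right (by linarith), max_eq_right (by linarith)]
    · rw [max_eq_right h1, max_eq_left h2, max_eq_right (by linarith), max_eq_right (by linarith)]
    · rw [max_eq_left h1, max_eq_right h2, max_eq_right (by linarith), max_eq_right (by linarith)]
    · rw [max_eq_left h1, max_eq_left h2]
      congr 1
      ring
  mul_mono x y z h := by
    have h' : (y : ℝ) ≤ z := h
    change max ((x : ℝ) + y - 1) 0 ≤ max ((x : ℝ) + z - 1) 0
    exact max_le_max (by linarith) le_rfl
  mul_one x := by
    apply Subtype.ext
    have hx := x.2.1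
    change max ((x : ℝ) + 1 - 1) 0 = x
    rw [max_eq_left (by linarith)]
    ring

/-- A continuous t-norm on `[0,1]`. -/
structure ContinuousTNorm extends TNorm where
  continuous_mul : Continuous (fun p : I × I => mul p.1 p.2)

variable {T : ContinuousTNorm}

/-- The implication `x → y` of a t-norm: the largest `z` with `x & z ≤ y`. -/
noncomputable def ContinuousTNorm.imp (T : ContinuousTNorm) (x y : I) : I :=
  sSup {z | T.mul x z ≤ y}

theorem ContinuousTNorm.mul_zero (T : ContinuousTNorm) (x : I) : T.mul x 0 = 0 := by
  apply le_antisymm _ (unitInterval.nonneg' (t := T.mul x 0))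
  rw [T.mul_comm]
  exact (T.mul_mono 0 x 1 unitInterval.le_one').trans_eq (T.mul_one 0)

/-- The implication is right adjoint to the t-norm. -/
theorem ContinuousTNorm.mul_le_iff (T : ContinuousTNorm) (x y z : I) :
    T.mul x z ≤ y ↔ z ≤ T.imp x y := by
  constructor
  · intro h
    exact le_sSup (show z ∈ {z | T.mul x z ≤ y} from h)
  · intro h
    have hc : IsClosed {z | T.mul x z ≤ y} :=
      isClosed_le (T.continuous_mul.comp (Continuous.prodMk_right x)) continuous_const
    have hne : {z | T.mul x z ≤ y}.Nonempty :=
      ⟨0, by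
        change T.mul x 0 ≤ y
        rw [T.mul_zero]
        exact unitInterval.nonneg'⟩
    have hm : T.imp x y ∈ {z | T.mul x z ≤ y} := hc.sSup_mem hne
    exact (T.mul_mono x _ _ h).trans hm

theorem ContinuousTNorm.mul_le_mul (T : ContinuousTNorm) {a b c d : I} (h : a ≤ c) (k : b ≤ d) :
    T.mul a b ≤ T.mul c d := by
  refine (T.mul_mono a b d k).trans ?_
  rw [T.mul_comm a, T.mul_comm c]
  exact T.mul_mono d a c h

theorem ContinuousTNorm.mul_imp_le (T : ContinuousTNorm) (x y : I) : T.mul x (T.imp x y) ≤ y :=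
  (T.mul_le_iff x y _).2 le_rfl

theorem ContinuousTNorm.iSup_mul_le (T : ContinuousTNorm) {ι : Type*} (f : ι → I) (b c : I)
    (h : ∀ i, T.mul (f i) b ≤ c) : T.mul (⨆ i, f i) b ≤ c := by
  rw [T.mul_comm, T.mul_le_iff]
  refine iSup_le fun i => ?_
  rw [← T.mul_le_iff, T.mul_comm]
  exact h i

theorem ContinuousTNorm.imp_self (T : ContinuousTNorm) (x : I) : T.imp x x = 1 :=
  le_antisymm unitInterval.le_one' ((T.mul_le_iff x x 1).1 (T.mul_one x).le)

theorem ContinuousTNorm.imp_trans (T : ContinuousTNorm) (x y z : I) :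
    T.mul (T.imp y z) (T.imp x y) ≤ T.imp x z := by
  rw [← T.mul_le_iff, T.mul_comm (T.imp y z), ← T.mul_assoc]
  exact (T.mul_le_mul (T.mul_imp_le x y) le_rfl).trans (T.mul_imp_le y z)

/-- A real-enriched category, with respect to a continuous t-norm. -/
structure RealCat (T : ContinuousTNorm) where
  carrier : Type u
  hom : carrier → carrier → I
  refl : ∀ x, hom x x = 1
  trans : ∀ x y z, T.mul (hom y z) (hom x y) ≤ hom x z

instance : CoeSort (RealCat.{u} T) (Type u) := ⟨RealCat.carrier⟩

/-- The opposite real-enriched category. -/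
abbrev RealCat.op (X : RealCat.{u} T) : RealCat.{u} T where
  carrier := X.carrier
  hom x y := X.hom y x
  refl x := X.refl x
  trans x y z := by
    rw [T.mul_comm]
    exact X.trans z y x

/-- The real-enriched category `V = ([0,1], α_L)` with `α_L x y = (x → y)`.
Its opposite is `([0,1], α_R)` with `α_R x y = (y → x)`. -/
noncomputable abbrev V (T : ContinuousTNorm) : RealCat.{0} T where
  carrier := I
  hom x y := T.imp x y
  refl x := T.imp_self x
  trans x y z := T.imp_trans x y z

/-- Functors between real-enriched categories. -/
structure RFunctor (X : RealCat.{u} T) (Y : RealCat.{v} T) where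
  toFun : X → Y
  map : ∀ x y, X.hom x y ≤ Y.hom (toFun x) (toFun y)

instance {X : RealCat.{u} T} {Y : RealCat.{v} T} : CoeFun (RFunctor X Y) (fun _ => X → Y) :=
  ⟨RFunctor.toFun⟩

/-- `f` is left adjoint to `g`. -/
def LeftAdjoint {X : RealCat.{u} T} {Y : RealCat.{v} T} (f : RFunctor X Y) (g : RFunctor Y X) :
    Prop :=
  ∀ (x : X) (y : Y), Y.hom (f x) y = X.hom x (g y)

/-- A weight of `X`: a distributor from `X` to the terminal category, that is, a functor from
the opposite of `X` to `V`. -/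
@[ext]
structure Weight (X : RealCat.{u} T) where
  val : X → I
  act : ∀ x y, T.mul (val y) (X.hom x y) ≤ val x

/-- The real-enriched category `P X` of weights of `X`. -/
noncomputable abbrev P (X : RealCat.{u} T) : RealCat.{u} T where
  carrier := Weight X
  hom φ ψ := ⨅ x : X, T.imp (φ.val x) (ψ.val x)
  refl φ := by
    apply le_antisymm unitInterval.le_one'
    exact le_iInf fun x => (T.imp_self (φ.val x)).ge
  trans φ ψ χ := le_iInf fun x =>
    (T.mul_le_mul (iInf_le _ x) (iInf_le _ x)).trans (T.imp_trans _ (ψ.val x) _)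

/-- The Yoneda embedding `a ↦ X(-, a)`. -/
noncomputable def yoneda (X : RealCat.{u} T) : RFunctor X (P X) where
  toFun a := ⟨fun x => X.hom x a, fun x y => X.trans x y a⟩
  map a b := le_iInf fun x => by
    rw [← T.mul_le_iff, T.mul_comm]
    exact X.trans x a b

/-- The presheaf functor `P` on morphisms: `P f` sends a weight `φ` of `X` to the composite
distributor `φ ∘ f^*`, where `f^*(y, x) = Y(y, f x)` is the cograph of `f`. -/
noncomputable def P.map {X : RealCat.{u} T} {Y : RealCat.{v} T} (f : RFunctor X Y) :
    RFunctor (P X) (P Y) where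
  toFun φ :=
    { val := fun y => ⨆ x : X, T.mul (φ.val x) (Y.hom y (f x))
      act := fun y y' => T.iSup_mul_le _ _ _ fun x => by
        rw [T.mul_assoc]
        exact (T.mul_mono _ _ _ (Y.trans y y' (f x))).trans
          (le_iSup (fun x : X => T.mul (φ.val x) (Y.hom y (f x))) x) }
  map φ ψ := le_iInf fun y => by
    rw [← T.mul_le_iff]
    refine T.iSup_mul_le _ _ _ fun x => ?_
    refine le_trans ?_ (le_iSup (fun x : X => T.mul (ψ.val x) (Y.hom y (f x))) x)
    change T.mul (T.mul (φ.val x) (Y.hom y (f x))) ((P X).hom φ ψ) ≤ _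
    rw [T.mul_assoc, T.mul_comm (Y.hom y (f x)), ← T.mul_assoc]
    refine T.mul_le_mul ?_ le_rfl
    rw [T.mul_le_iff]
    exact iInf_le _ x

/-- The multiplication of the presheaf monad: it sends a weight `Φ` of `P X` to its colimit in
`P X`, the composite distributor `Φ ∘ y_*`, where `y_*(x, φ) = P X (y x, φ)` is the graph of the
Yoneda embedding. -/
noncomputable def P.mult (X : RealCat.{u} T) : RFunctor (P (P X)) (P X) where
  toFun Φ :=
    { val := fun x => ⨆ φ : P X, T.mul (Φ.val φ) ((P X).hom (yoneda X x) φ)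
      act := fun x x' => T.iSup_mul_le _ _ _ fun φ => by
        rw [T.mul_assoc]
        refine (T.mul_mono _ _ _ ?_).trans
          (le_iSup (fun φ : P X => T.mul (Φ.val φ) ((P X).hom (yoneda X x) φ)) φ)
        exact (T.mul_mono _ _ _ ((yoneda X).map x x')).trans ((P X).trans _ _ _) }
  map Φ Ψ := le_iInf fun x => by
    rw [← T.mul_le_iff]
    refine T.iSup_mul_le _ _ _ fun φ => ?_
    refine le_trans ?_
      (le_iSup (fun φ : P X => T.mul (Ψ.val φ) ((P X).hom (yoneda X x) φ)) φ)
    change T.mul (T.mul (Φ.val φ) ((P X).hom (yoneda X x) φ)) ((P (P X)).hom Φ Ψ) ≤ _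
    rw [T.mul_assoc, T.mul_comm ((P X).hom (yoneda X x) φ), ← T.mul_assoc]
    refine T.mul_le_mul ?_ le_rfl
    rw [T.mul_le_iff]
    exact iInf_le _ φ

/-- `(A, h)` is an Eilenberg-Moore algebra of the presheaf monad. -/
structure IsPAlgebra (A : RealCat.{u} T) (h : RFunctor (P A) A) : Prop where
  unit : ∀ a : A, h (yoneda A a) = a
  assoc : ∀ Φ : P (P A), h (P.map h Φ) = h (P.mult A Φ)

/-- A completely distributive real-enriched category is a continuous algebra of the presheaf
monad: an algebra for which the left adjoint `colim` of the Yoneda embedding has a left adjoint. -/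
def CompletelyDistributive (A : RealCat.{u} T) : Prop :=
  (∃ h : RFunctor (P A) A, IsPAlgebra A h) ∧
    ∃ colim : RFunctor (P A) A, LeftAdjoint colim (yoneda A) ∧
      ∃ d : RFunctor A (P A), LeftAdjoint d colim

end RealEnriched

/-!
Each of the three conditions is equivalent to the negation `¬ x = (x → 0)` being an involution.

If it is, then pointwise negation identifies `(P X)ᵒᵖ` with `P (Xᵒᵖ)`. For `X` completely
distributive, `colim : P X → X` has the right adjoint `y` and a left adjoint `d`, so its opposite
is a retraction of `P (Xᵒᵖ)` onto `Xᵒᵖ` with a left and a right adjoint, and such a retract of a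
category of weights is completely distributive (`completelyDistributive_of_retract`,
`CompletelyDistributive.op`). As `V` is the category of weights of a point, it is completely
distributive, and hence so is `Vᵒᵖ` as soon as complete distributivity is self-dual.

Conversely, if `Vᵒᵖ` is completely distributive, the adjunction `d ⊣ colim`, tested against the
zero weight, writes each `b` as a meet of negations, so `¬ ¬ b = b`
(`isInvolutive_of_completelyDistributive_op`).

Finally, a continuous t-norm with involutive negation is isomorphic to the Łukasiewicz t-norm
(`ContinuousTNorm.IsInvolutive.isomorphic_lukasiewicz`). The only idempotents are `0` and `1`,
whence powers of `z < 1` tend to `0`, the t-norm is cancellative away from `0`, and iterated square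
roots of a nonzero element tend to `1`. Starting from a nonzero `p` with `p & p = 0`, the powers of
the iterated square roots of `p` fill out to a one-parameter semigroup `c` with
`c (s + t) = c s & c t`. Up to its first zero `τ` it decreases strictly from `1` to `0` and takes
all values, so `s ↦ c (τ * (1 - s))` is an isomorphism from the Łukasiewicz t-norm.
-/

namespace RealEnriched

variable {T : ContinuousTNorm}

/-! ### Residuation -/

namespace ContinuousTNorm

theorem mul_le_left (T : ContinuousTNorm) (x y : I) : T.mul x y ≤ x :=
  (T.mul_mono x y 1 unitInterval.le_one').trans_eq (T.mul_one x)

theorem one_mul (T : ContinuousTNorm) (x : I) : T.mul 1 x = x := by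
  rw [T.mul_comm, T.mul_one]

theorem imp_mul (T : ContinuousTNorm) (a b c : I) : T.imp (T.mul a b) c = T.imp a (T.imp b c) := by
  refine eq_of_forall_le_iff fun z => ?_
  rw [← T.mul_le_iff, ← T.mul_le_iff, ← T.mul_le_iff, T.mul_comm a b, T.mul_assoc]

theorem imp_comm (T : ContinuousTNorm) (a b c : I) :
    T.imp a (T.imp b c) = T.imp b (T.imp a c) := by
  rw [← T.imp_mul, T.mul_comm, T.imp_mul]

theorem one_imp (T : ContinuousTNorm) (a : I) : T.imp 1 a = a := by
  refine eq_of_forall_le_iff fun z => ?_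
  rw [← T.mul_le_iff, T.one_mul]

theorem imp_eq_one_iff (T : ContinuousTNorm) {a b : I} : T.imp a b = 1 ↔ a ≤ b := by
  rw [← unitInterval.le_one'.ge_iff_eq, ← T.mul_le_iff, T.mul_one]

theorem imp_lt_iff (T : ContinuousTNorm) {x y z : I} : T.imp x y < z ↔ y < T.mul x z := by
  rw [← not_le, ← T.mul_le_iff, not_le]

theorem iSup_imp (T : ContinuousTNorm) {ι : Type*} (f : ι → I) (b : I) :
    T.imp (⨆ i, f i) b = ⨅ i, T.imp (f i) b := by
  refine eq_of_forall_le_iff fun z => ?_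
  rw [le_iInf_iff, ← T.mul_le_iff]
  simp only [← T.mul_le_iff]
  exact ⟨fun h i => (T.mul_le_mul (le_iSup f i) le_rfl).trans h, T.iSup_mul_le f z b⟩

theorem imp_iInf (T : ContinuousTNorm) {ι : Type*} (a : I) (f : ι → I) :
    T.imp a (⨅ i, f i) = ⨅ i, T.imp a (f i) := by
  refine eq_of_forall_le_iff fun z => ?_
  simp only [le_iInf_iff, ← T.mul_le_iff]

/-- The negation `x → 0`. -/
noncomputable def neg (T : ContinuousTNorm) (x : I) : I := T.imp x 0

/-- The negation `x → 0` is an involution, that is, `0` is a dualizing element. -/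
def IsInvolutive (T : ContinuousTNorm) : Prop := ∀ x, T.neg (T.neg x) = x

theorem le_neg_iff (T : ContinuousTNorm) {x y : I} : x ≤ T.neg y ↔ T.mul y x = 0 := by
  rw [neg, ← T.mul_le_iff]
  exact ⟨fun h => le_antisymm h unitInterval.nonneg', fun h => h.le⟩

theorem IsInvolutive.imp_eq_neg_imp_neg (hT : T.IsInvolutive) (x y : I) :
    T.imp x y = T.imp (T.neg y) (T.neg x) := by
  conv_lhs => rw [← hT y]
  exact T.imp_comm x (T.neg y) 0

theorem IsInvolutive.imp_neg (hT : T.IsInvolutive) (x y : I) :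
    T.imp (T.neg x) y = T.imp (T.neg y) x := by
  rw [hT.imp_eq_neg_imp_neg, hT x]

end ContinuousTNorm

/-! ### Weights and adjunctions -/

/-- The Yoneda lemma. -/
theorem yoneda_hom (X : RealCat.{u} T) (a : X) (φ : Weight X) :
    (P X).hom (yoneda X a) φ = φ.val a := by
  apply le_antisymm
  · refine (iInf_le _ a).trans ?_
    change T.imp (X.hom a a) (φ.val a) ≤ φ.val a
    rw [X.refl, T.one_imp]
  · refine le_iInf fun x => ?_
    rw [← T.mul_le_iff, T.mul_comm]
    exact φ.act x a

/-- `P f` is left adjoint to the restriction of weights along `f`. -/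
theorem P.map_hom {X : RealCat.{u} T} {Y : RealCat.{v} T} (f : RFunctor X Y) (φ : Weight X)
    (ψ : Weight Y) : (P Y).hom (P.map f φ) ψ = ⨅ x, T.imp (φ.val x) (ψ.val (f x)) := by
  change (⨅ y, T.imp (⨆ x, T.mul (φ.val x) (Y.hom y (f x))) (ψ.val y)) = _
  simp only [T.iSup_imp, T.imp_mul]
  rw [iInf_comm]
  refine iInf_congr fun x => ?_
  rw [← T.imp_iInf]
  exact congrArg _ (yoneda_hom Y (f x) ψ)

/-- The universal property of `P.mult X Φ` as the colimit of the identity weighted by `Φ`. -/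
theorem P.mult_hom (X : RealCat.{u} T) (Φ : Weight (P X)) (ψ : Weight X) :
    (P X).hom (P.mult X Φ) ψ = ⨅ φ : P X, T.imp (Φ.val φ) ((P X).hom φ ψ) := by
  have hval : (P.mult X Φ).val = fun x => ⨆ φ : Weight X, T.mul (Φ.val φ) (φ.val x) :=
    funext fun x => iSup_congr fun φ => congrArg _ (yoneda_hom X x φ)
  change (⨅ x, T.imp ((P.mult X Φ).val x) (ψ.val x)) = _
  simp only [hval, T.iSup_imp, T.imp_mul]
  rw [iInf_comm]
  refine iInf_congr fun φ => ?_
  rw [← T.imp_iInf]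

/-- Isomorphic objects are equal. -/
def RealCat.Separated (X : RealCat.{u} T) : Prop :=
  ∀ a b : X, X.hom a b = 1 → X.hom b a = 1 → a = b

theorem RealCat.Separated.ext {X : RealCat.{u} T} (hX : X.Separated) {a b : X}
    (h : ∀ x, X.hom a x = X.hom b x) : a = b :=
  hX a b (by rw [h, X.refl]) (by rw [← h, X.refl])

/-- A map satisfying the adjunction identity with a functor on its right is a functor. -/
def RFunctor.ofAdjunction {X : RealCat.{u} T} {Y : RealCat.{v} T} (f : X → Y) (g : RFunctor Y X)
    (h : ∀ x y, Y.hom (f x) y = X.hom x (g y)) : RFunctor X Y where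
  toFun := f
  map x x' := by
    have h1 : X.hom x' (g (f x')) = 1 := by rw [← h, Y.refl]
    have h2 := X.trans x x' (g (f x'))
    rwa [h1, T.one_mul, ← h] at h2

/-- For a separated category the Eilenberg–Moore laws and the functoriality of the adjoints are
automatic: complete distributivity amounts to the two adjunction identities. -/
theorem completelyDistributive_of_adjunctions {A : RealCat.{u} T} (hA : A.Separated)
    (c : Weight A → A) (hc : ∀ φ a, A.hom (c φ) a = (P A).hom φ (yoneda A a))
    (d : A → Weight A) (hd : ∀ a φ, (P A).hom (d a) φ = A.hom a (c φ)) :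
    CompletelyDistributive A := by
  let C : RFunctor (P A) A := RFunctor.ofAdjunction c (yoneda A) hc
  refine ⟨⟨C, ?_, ?_⟩, C, hc, RFunctor.ofAdjunction d C hd, hd⟩
  · intro a
    refine hA.ext fun b => ?_
    change A.hom (c (yoneda A a)) b = A.hom a b
    rw [hc, yoneda_hom]
    rfl
  · intro Φ
    refine hA.ext fun b => ?_
    change A.hom (c (P.map C Φ)) b = A.hom (c (P.mult A Φ)) b
    rw [hc, hc, P.map_hom, P.mult_hom]
    exact iInf_congr fun φ => congrArg _ (hc φ b)

theorem CompletelyDistributive.exists_adjunctions {A : RealCat.{u} T}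
    (h : CompletelyDistributive A) :
    A.Separated ∧ ∃ c : Weight A → A, (∀ φ a, A.hom (c φ) a = (P A).hom φ (yoneda A a)) ∧
      ∃ d : A → Weight A, ∀ a φ, (P A).hom (d a) φ = A.hom a (c φ) := by
  obtain ⟨⟨h, hh⟩, c, hc, d, hd⟩ := h
  refine ⟨fun a b hab hba => ?_, c, hc, d, hd⟩
  -- Isomorphic objects represent the same weight, and the unit law recovers them from it.
  have key : ∀ {a b : A}, A.hom a b = 1 → ∀ x, A.hom x a ≤ A.hom x b := fun {a b} hab x => by
    have := A.trans x a b
    rwa [hab, T.one_mul] at this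
  rw [← hh.unit a, ← hh.unit b]
  congr 1
  ext x
  exact congrArg _ (le_antisymm (key hab x) (key hba x))

/-- A category which is a retract of a category of weights `P Z`, along a functor `q` with a left
adjoint section `l` and a right adjoint `r`, is completely distributive. The colimit of `φ` is
`q (φ ∘ q ∘ y)`, and its left adjoint sends `b` to the image of the weight `l b` under `q ∘ y`. -/
theorem completelyDistributive_of_retract {Z : RealCat.{v} T} {B : RealCat.{u} T}
    (hB : B.Separated) (q : RFunctor (P Z) B) (l r : B → Weight Z)
    (hl : ∀ b φ, (P Z).hom (l b) φ = B.hom b (q φ)) (hql : ∀ b, q (l b) = b)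
    (hr : ∀ φ b, B.hom (q φ) b = (P Z).hom φ (r b)) : CompletelyDistributive B := by
  let qy : RFunctor Z B := ⟨fun z => q (yoneda Z z), fun z z' =>
    ((yoneda Z).map z z').trans (q.map _ _)⟩
  let res : Weight B → Weight Z := fun φ => ⟨fun z => φ.val (qy z), fun z z' =>
    (T.mul_mono _ _ _ (qy.map z z')).trans (φ.act _ _)⟩
  refine completelyDistributive_of_adjunctions hB (fun φ => q (res φ)) (fun φ b => ?_)
    (fun b => P.map qy (l b)) (fun b φ => ?_)
  · have hrb : ∀ z, (r b).val z = B.hom (qy z) b := fun z => by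
      change _ = B.hom (q (yoneda Z z)) b
      rw [hr, yoneda_hom]
    rw [hr]
    apply le_antisymm
    · refine le_iInf fun x => ?_
      rw [← T.mul_le_iff]
      change _ ≤ B.hom x b
      conv_rhs => rw [← hql x, hr]
      refine le_iInf fun z => ?_
      rw [← T.mul_le_iff, hrb]
      have h1 : (l x).val z ≤ B.hom (qy z) x := by
        rw [← yoneda_hom]
        refine (q.map _ _).trans ?_
        rw [hql]
      have h2 : T.mul (φ.val x) ((l x).val z) ≤ φ.val (qy z) :=
        (T.mul_mono _ _ _ h1).trans (φ.act _ _)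
      rw [← T.mul_assoc, T.mul_comm ((l x).val z)]
      refine (T.mul_le_mul h2 (iInf_le _ z)).trans ?_
      rw [hrb]
      exact T.mul_imp_le _ _
    · refine le_iInf fun z => ?_
      rw [hrb]
      exact iInf_le (fun x => T.imp (φ.val x) (B.hom x b)) (qy z)
  · rw [P.map_hom, ← hl]

/-- Complete distributivity is invariant under isomorphism, also across universes. -/
theorem CompletelyDistributive.of_equiv {X : RealCat.{u} T} {Y : RealCat.{v} T}
    (h : CompletelyDistributive X) (e : X.carrier ≃ Y.carrier)
    (he : ∀ a b, Y.hom (e a) (e b) = X.hom a b) : CompletelyDistributive Y := by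
  obtain ⟨hX, c, hc, d, hd⟩ := h.exists_adjunctions
  have he' : ∀ a b, X.hom (e.symm a) (e.symm b) = Y.hom a b := fun a b => by
    rw [← he, e.apply_symm_apply, e.apply_symm_apply]
  have he1 : ∀ a b, Y.hom (e a) b = X.hom a (e.symm b) := fun a b => by
    rw [← he, e.apply_symm_apply]
  let pull : Weight Y → Weight X := fun φ => ⟨fun x => φ.val (e x), fun x y => by
    rw [← he]
    exact φ.act _ _⟩
  let push : Weight X → Weight Y := fun φ => ⟨fun x => φ.val (e.symm x), fun x y => by
    rw [← he']
    exact φ.act _ _⟩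
  refine completelyDistributive_of_adjunctions ?_ (fun φ => e (c (pull φ))) ?_
    (fun b => push (d (e.symm b))) ?_
  · intro a b hab hba
    exact e.symm.injective (hX _ _ ((he' _ _).trans hab) ((he' _ _).trans hba))
  · intro φ a
    rw [he1, hc]
    refine e.iInf_congr fun x => ?_
    change T.imp (φ.val (e x)) (Y.hom (e x) a) = T.imp (φ.val (e x)) (X.hom x (e.symm a))
    rw [he1]
  · intro a φ
    have h1 : Y.hom a (e (c (pull φ))) = X.hom (e.symm a) (c (pull φ)) := by
      rw [← he', e.symm_apply_apply]
    rw [h1, ← hd]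
    refine e.symm.iInf_congr fun y => ?_
    change T.imp _ (φ.val (e (e.symm y))) = T.imp _ (φ.val y)
    rw [e.apply_symm_apply]

/-! ### Duality under an involutive negation -/

/-- The pointwise negation of a weight, a weight of the opposite category. -/
noncomputable def Weight.neg {X : RealCat.{u} T} (φ : Weight X) : Weight X.op where
  val x := T.neg (φ.val x)
  act x y := by
    have h := φ.act y x
    change T.mul (T.neg (φ.val y)) (X.hom y x) ≤ T.imp (φ.val x) 0
    rw [← T.mul_le_iff, T.mul_comm (T.neg _), ← T.mul_assoc]
    exact (T.mul_le_mul h le_rfl).trans (T.mul_imp_le _ _)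

theorem ContinuousTNorm.IsInvolutive.hom_neg (hT : T.IsInvolutive) {X : RealCat.{u} T}
    (φ : Weight X) (ψ : Weight X.op) : (P X.op).hom φ.neg ψ = (P X).hom ψ.neg φ :=
  iInf_congr fun _ => hT.imp_neg _ _

theorem Weight.hom_neg_right {X : RealCat.{u} T}
    (φ : Weight X) (ψ : Weight X.op) : (P X.op).hom ψ φ.neg = (P X).hom φ ψ.neg :=
  iInf_congr fun _ => T.imp_comm _ _ _

/-- Negation identifies `(P X)ᵒᵖ` with `P (Xᵒᵖ)`; thus the opposite of `colim : P X → X`, with its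
adjoints exchanged, exhibits `Xᵒᵖ` as a retract of `P (Xᵒᵖ)`. -/
theorem CompletelyDistributive.op (hT : T.IsInvolutive) {X : RealCat.{u} T}
    (h : CompletelyDistributive X) : CompletelyDistributive X.op := by
  obtain ⟨hX, c, hc, d, hd⟩ := h.exists_adjunctions
  have hl : ∀ (b : X.op) (φ : Weight X.op),
      (P X.op).hom (yoneda X b).neg φ = X.op.hom b (c φ.neg) := fun b φ => by
    rw [hT.hom_neg]
    exact (hc _ _).symm
  have hr : ∀ (φ : Weight X.op) (b : X.op),
      X.op.hom (c φ.neg) b = (P X.op).hom φ (d b).neg := fun φ b => by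
    rw [Weight.hom_neg_right]
    exact (hd _ _).symm
  let q : RFunctor (P X.op) X.op := ⟨fun φ => c φ.neg, fun φ ψ => by
    rw [hr, Weight.hom_neg_right]
    have h1 : (P X).hom (d (c ψ.neg)) ψ.neg = 1 := by rw [hd, X.refl]
    have h2 : (P X.op).hom ψ (d (c ψ.neg)).neg = 1 := by rw [Weight.hom_neg_right, h1]
    have h3 := (P X.op).trans φ ψ (d (c ψ.neg)).neg
    rw [h2, T.one_mul, Weight.hom_neg_right] at h3
    exact h3⟩
  refine completelyDistributive_of_retract (Z := X.op) (fun a b hab hba => hX a b hba hab) q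
    (fun b => (yoneda X b).neg) (fun b => (d b).neg) hl (fun b => ?_) hr
  refine hX.ext fun x => ?_
  change X.hom (c (yoneda X b).neg.neg) x = X.hom b x
  have h1 : (yoneda X b).neg.neg = yoneda X b := Weight.ext (funext fun _ => hT _)
  rw [h1, hc, yoneda_hom]
  rfl

/-! ### The category `V` and its opposite -/

theorem separated_V (T : ContinuousTNorm) : (V T).Separated := fun _ _ hab hba =>
  le_antisymm (T.imp_eq_one_iff.1 hab) (T.imp_eq_one_iff.1 hba)

/-- A constant map is a weight. -/
def Weight.const (X : RealCat.{u} T) (b : I) : Weight X :=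
  ⟨fun _ => b, fun _ _ => T.mul_le_left _ _⟩

/-- `V` is the category of weights of the one-object category: `colim` is evaluation at `1`, and
its left adjoint sends `b` to the constant weight `b`. -/
theorem completelyDistributive_V (T : ContinuousTNorm) : CompletelyDistributive (V T) := by
  have h1 : ∀ (φ : Weight (V T)) x, φ.val 1 ≤ φ.val x := fun φ x => by
    have := φ.act x 1
    rwa [show (V T).hom x 1 = 1 from T.imp_eq_one_iff.2 unitInterval.le_one', T.mul_one] at this
  have h2 : ∀ (φ : Weight (V T)) x, T.mul (φ.val x) x ≤ φ.val 1 := fun φ x => by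
    have := φ.act 1 x
    rwa [show (V T).hom 1 x = x from T.one_imp x] at this
  refine completelyDistributive_of_adjunctions (separated_V T) (fun φ => φ.val 1) (fun φ a => ?_)
    (fun b => Weight.const _ b) (fun b φ => ?_)
  · refine eq_of_forall_le_iff fun z => ?_
    change z ≤ T.imp (φ.val 1) a ↔ z ≤ ⨅ x, T.imp (φ.val x) (T.imp x a)
    simp only [← T.imp_mul, le_iInf_iff, ← T.mul_le_iff]
    refine ⟨fun h x => (T.mul_le_mul (h2 φ x) le_rfl).trans h, fun h => ?_⟩
    simpa only [T.mul_one] using h 1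
  · change (⨅ x, T.imp b (φ.val x)) = T.imp b (φ.val 1)
    rw [← T.imp_iInf]
    exact congrArg _ (le_antisymm (iInf_le _ 1) (le_iInf (h1 φ)))

/-- In `Vᵒᵖ` the colimit of a weight `φ` is `⨅ x, φ x → x`, so the zero weight has colimit `1`.
Testing the adjunction `d ⊣ colim` against it gives `⨅ x, ¬ d b x = b`: every `b` is a meet of
negations. -/
theorem isInvolutive_of_completelyDistributive_op
    (h : CompletelyDistributive (V T).op) : T.IsInvolutive := by
  obtain ⟨-, c, hc, d, hd⟩ := h.exists_adjunctions
  intro b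
  have hc0 : c (Weight.const _ 0) = (1 : I) := by
    have := hc (Weight.const _ 0) (1 : I)
    change T.imp 1 (c (Weight.const _ 0)) = ⨅ x : I, T.imp 0 (T.imp 1 x) at this
    rw [T.one_imp] at this
    rw [this]
    refine le_antisymm unitInterval.le_one' (le_iInf fun x => ?_)
    exact (T.imp_eq_one_iff.2 unitInterval.nonneg').ge
  have hb : (⨅ x : I, T.neg ((d b).val x)) = b := by
    have := hd b (Weight.const _ 0)
    change (⨅ x : I, T.neg ((d b).val x)) = T.imp (c (Weight.const _ 0)) b at this
    rw [this, hc0, T.one_imp]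
  apply le_antisymm
  · conv_rhs => rw [← hb]
    refine le_iInf fun x => ?_
    have h1 : (d b).val x ≤ T.neg b := by
      rw [T.le_neg_iff, T.mul_comm, ← T.le_neg_iff]
      exact hb.ge.trans (iInf_le _ x)
    rw [T.le_neg_iff]
    refine le_antisymm ((T.mul_le_mul h1 le_rfl).trans ?_) unitInterval.nonneg'
    exact T.mul_imp_le _ _
  · rw [T.le_neg_iff, T.mul_comm, ← T.le_neg_iff]

/-! ### T-norms isomorphic to the Łukasiewicz t-norm have an involutive negation -/

theorem isInvolutive_of_isomorphic (h : T.toTNorm.Isomorphic lukasiewicz) : T.IsInvolutive := by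
  obtain ⟨f, hf⟩ := h
  have h0 : (f 0 : ℝ) = 0 := by
    have : f 0 = 0 := f.map_bot
    rw [this]
    rfl
  have key : ∀ x y, T.mul x y = 0 ↔ (f x : ℝ) + f y ≤ 1 := fun x y => by
    rw [← f.injective.eq_iff, hf, Subtype.ext_iff, h0]
    change max ((f x : ℝ) + f y - 1) 0 = 0 ↔ _
    rw [max_eq_right_iff]
    constructor <;> intro h <;> linarith
  have hneg : ∀ x, (f (T.neg x) : ℝ) = 1 - f x := fun x => by
    apply le_antisymm
    · have := (key x (T.neg x)).1 (T.le_neg_iff.1 le_rfl)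
      linarith
    · have h1 : f.symm (σ (f x)) ≤ T.neg x := by
        rw [T.le_neg_iff, key, f.apply_symm_apply]
        simp
      have h2 := f.monotone h1
      rw [f.apply_symm_apply] at h2
      exact h2
  intro x
  apply f.injective
  apply Subtype.ext
  rw [hneg, hneg]
  ring

/-! ### Powers and idempotents -/

namespace ContinuousTNorm

/-- The `n`-fold power of `x` with respect to the t-norm. -/
def pow (T : ContinuousTNorm) (x : I) : ℕ → I
  | 0 => 1
  | n + 1 => T.mul (T.pow x n) x

theorem pow_add (T : ContinuousTNorm) (x : I) (m n : ℕ) :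
    T.pow x (m + n) = T.mul (T.pow x m) (T.pow x n) := by
  induction n with
  | zero => exact (T.mul_one _).symm
  | succ n ih =>
    change T.mul (T.pow x (m + n)) x = T.mul (T.pow x m) (T.mul (T.pow x n) x)
    rw [ih, T.mul_assoc]

theorem pow_antitone (T : ContinuousTNorm) (x : I) : Antitone (T.pow x) :=
  antitone_nat_of_succ_le fun _ => T.mul_le_left _ _

theorem pow_mul_self (T : ContinuousTNorm) (x : I) (n : ℕ) :
    T.pow (T.mul x x) n = T.pow x (2 * n) := by
  induction n with
  | zero => rfl
  | succ n ih =>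
    change T.mul (T.pow (T.mul x x) n) (T.mul x x) = T.mul (T.mul (T.pow x (2 * n)) x) x
    rw [ih, T.mul_assoc]

theorem tendsto_mul (T : ContinuousTNorm) {α : Type*} {l : Filter α} {f g : α → I} {a b : I}
    (hf : Filter.Tendsto f l (nhds a)) (hg : Filter.Tendsto g l (nhds b)) :
    Filter.Tendsto (fun i => T.mul (f i) (g i)) l (nhds (T.mul a b)) :=
  (T.continuous_mul.tendsto (a, b)).comp (hf.prodMk_nhds hg)

/-- A continuous t-norm is divisible. -/
theorem exists_mul_eq (T : ContinuousTNorm) {x y : I} (h : x ≤ y) : ∃ z, T.mul y z = x := by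
  have hc : Continuous (T.mul y) := T.continuous_mul.comp (Continuous.prodMk_right y)
  apply mem_range_of_exists_le_of_exists_ge hc
  · exact ⟨0, by rw [T.mul_zero]; exact unitInterval.nonneg'⟩
  · exact ⟨1, by rwa [T.mul_one]⟩

theorem exists_mul_self_eq (T : ContinuousTNorm) (x : I) : ∃ z, T.mul z z = x := by
  have hc : Continuous fun z => T.mul z z :=
    T.continuous_mul.comp (continuous_id.prodMk continuous_id)
  apply mem_range_of_exists_le_of_exists_ge hc
  · exact ⟨0, by rw [T.mul_zero]; exact unitInterval.nonneg'⟩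
  · exact ⟨1, by rw [T.mul_one]; exact unitInterval.le_one'⟩

/-- By divisibility an idempotent `e` satisfies `e & z = z` for `z ≤ e`. If `e ≠ 0`, this makes
the negation of `e` vanish, so that `e = ¬¬e = 1`. -/
theorem IsInvolutive.eq_zero_or_one (hT : T.IsInvolutive) {e : I} (he : T.mul e e = e) :
    e = 0 ∨ e = 1 := by
  by_contra! hne
  have h0 : T.neg e = 0 := by
    rcases le_total (T.neg e) e with h | h
    · obtain ⟨z, hz⟩ := T.exists_mul_eq h
      have h1 : T.mul e (T.neg e) = 0 := T.le_neg_iff.1 le_rfl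
      rwa [← hz, ← T.mul_assoc, he, hz] at h1
    · exact absurd (he.symm.trans (T.le_neg_iff.1 h)) hne.1
  have h1 := hT e
  rw [h0] at h1
  exact hne.2 (h1.symm.trans (T.imp_self 0))

theorem IsInvolutive.tendsto_pow (hT : T.IsInvolutive) {z : I} (hz : z ≠ 1) :
    Filter.Tendsto (T.pow z) Filter.atTop (nhds 0) := by
  have hlim := tendsto_atTop_iInf (T.pow_antitone z)
  have hsq : T.mul (⨅ n, T.pow z n) (⨅ n, T.pow z n) = ⨅ n, T.pow z n := by
    refine tendsto_nhds_unique (T.tendsto_mul hlim hlim) ?_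
    simp only [← T.pow_add]
    exact hlim.comp (Filter.tendsto_atTop_mono (fun n => Nat.le_add_left n n) Filter.tendsto_id)
  rcases hT.eq_zero_or_one hsq with h | h
  · rwa [h] at hlim
  · refine absurd (le_antisymm unitInterval.le_one' ?_) hz
    rw [← h]
    exact (iInf_le _ 1).trans_eq (T.one_mul z)

/-- Cancellation away from `0`: if `w & z = w` then `w = w & z ^ n` for all `n`, and `z ^ n` tends
to `0` unless `z = 1`. -/
theorem IsInvolutive.eq_one_of_mul_eq_self (hT : T.IsInvolutive) {w z : I} (hw : w ≠ 0)
    (h : T.mul w z = w) : z = 1 := by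
  by_contra hz
  have hp : ∀ n, T.mul w (T.pow z n) = w := fun n => by
    induction n with
    | zero => exact T.mul_one w
    | succ n ih =>
      change T.mul w (T.mul (T.pow z n) z) = w
      rw [← T.mul_assoc, ih, h]
  have h1 := T.tendsto_mul (tendsto_const_nhds (x := w)) (hT.tendsto_pow hz)
  simp only [hp, T.mul_zero] at h1
  exact hw (tendsto_nhds_unique tendsto_const_nhds h1)

/-- A sequence of iterated square roots of a nonzero element converges to `1`: its limit is a
nonzero idempotent. -/
theorem IsInvolutive.tendsto_of_mul_self (hT : T.IsInvolutive) {a : ℕ → I} (h0 : a 0 ≠ 0)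
    (ha : ∀ n, T.mul (a (n + 1)) (a (n + 1)) = a n) :
    Filter.Tendsto a Filter.atTop (nhds 1) := by
  have hmono : Monotone a := monotone_nat_of_le_succ fun n => by
    rw [← ha n]
    exact T.mul_le_left _ _
  have hlim := tendsto_atTop_iSup hmono
  have hlim' := hlim.comp (Filter.tendsto_add_atTop_nat 1)
  have hsq : T.mul (⨆ n, a n) (⨆ n, a n) = ⨆ n, a n := by
    refine tendsto_nhds_unique (T.tendsto_mul hlim' hlim') ?_
    simp only [Function.comp_apply, ha]
    exact hlim
  rcases hT.eq_zero_or_one hsq with h | h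
  · exact absurd (le_antisymm ((le_iSup a 0).trans_eq h) unitInterval.nonneg') h0
  · rwa [h] at hlim

end ContinuousTNorm

/-! ### One-parameter semigroups -/

/-- An antitone one-parameter semigroup for the t-norm, reaching the value `0`, and continuous at
time `0`. Times are nonnegative; the values of `c` at negative times play no role. -/
structure IsSemigroup (T : ContinuousTNorm) (c : ℝ → I) : Prop where
  zero : c 0 = 1
  add : ∀ s t, 0 ≤ s → 0 ≤ t → c (s + t) = T.mul (c s) (c t)
  anti : Antitone c
  exists_eq_zero : ∃ t, 0 ≤ t ∧ c t = 0
  exists_lt : ∀ z : I, z < 1 → ∀ ε : ℝ, 0 < ε → ∃ δ, 0 < δ ∧ δ ≤ ε ∧ z < c δ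

/-- The semigroup is `c t = lim (u n) ^ ⌊t * 2 ^ n⌋`, where `u` is a sequence of iterated square
roots of an element `u 0` with `0 < u 0` and `u 0 & u 0 = 0`. -/
theorem ContinuousTNorm.IsInvolutive.exists_isSemigroup (hT : T.IsInvolutive) :
    ∃ c, IsSemigroup T c := by
  obtain ⟨p, hp0, hpp⟩ : ∃ p : I, p ≠ 0 ∧ T.mul p p = 0 := by
    obtain ⟨x, hx0, hx1⟩ : ∃ x : I, 0 < x ∧ x < 1 := exists_between zero_lt_one
    refine ⟨min x (T.neg x), ?_, ?_⟩
    · rcases min_choice x (T.neg x) with h | h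
      · rw [h]
        exact hx0.ne'
      · rw [h]
        intro h0
        have := hT x
        rw [h0] at this
        exact hx1.ne (this.symm.trans (T.imp_self 0))
    · refine le_antisymm ((T.mul_le_mul (min_le_left _ _) (min_le_right _ _)).trans ?_)
        unitInterval.nonneg'
      exact T.mul_imp_le _ _
  choose root hroot using T.exists_mul_self_eq
  let u : ℕ → I := fun n => root^[n] p
  have hu : ∀ n, T.mul (u (n + 1)) (u (n + 1)) = u n := fun n => by
    simp only [u, Function.iterate_succ_apply', hroot]
  have hu1 := hT.tendsto_of_mul_self (a := u) hp0 hu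
  let k : ℝ → ℕ → ℕ := fun t n => ⌊t * 2 ^ n⌋₊
  let E : ℝ → ℕ → I := fun t n => T.pow (u n) (k t n)
  have hE : ∀ t, Antitone (E t) := fun t => antitone_nat_of_succ_le fun n => by
    have h1 : 2 * k t n ≤ k t (n + 1) := by
      rcases le_total 0 t with ht | ht
      · apply Nat.le_floor
        have := Nat.floor_le (show 0 ≤ t * 2 ^ n by positivity)
        simp only [k]
        push_cast
        rw [pow_succ]
        linarith
      · have : k t n = 0 :=
          Nat.floor_of_nonpos (mul_nonpos_of_nonpos_of_nonneg ht (by positivity))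
        omega
    calc E t (n + 1) ≤ T.pow (u (n + 1)) (2 * k t n) := T.pow_antitone _ h1
      _ = E t n := by rw [← T.pow_mul_self, hu]
  let c : ℝ → I := fun t => ⨅ n, E t n
  have hc : ∀ t, Filter.Tendsto (E t) Filter.atTop (nhds (c t)) := fun t =>
    tendsto_atTop_iInf (hE t)
  have hupow : ∀ n, T.pow (u n) (2 ^ n) = p := fun n => by
    induction n with
    | zero => exact T.one_mul p
    | succ n ih => rw [pow_succ, mul_comm, ← T.pow_mul_self, hu, ih]
  have hc1 : c 1 = p := by
    have : E 1 = fun _ => p := funext fun n => by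
      have hk : k 1 n = 2 ^ n := by
        simp only [k, _root_.one_mul]
        exact_mod_cast Nat.floor_natCast (R := ℝ) (2 ^ n)
      simp only [E, hk, hupow]
    refine tendsto_nhds_unique (hc 1) ?_
    rw [this]
    exact tendsto_const_nhds
  have hc0 : c 0 = 1 := by
    have : E 0 = fun _ => 1 := funext fun n => by
      simp only [E, k, zero_mul, Nat.floor_zero]
      rfl
    refine tendsto_nhds_unique (hc 0) ?_
    rw [this]
    exact tendsto_const_nhds
  have hadd : ∀ s t, 0 ≤ s → 0 ≤ t → c (s + t) = T.mul (c s) (c t) := fun s t hs ht => by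
    have hlim := T.tendsto_mul (hc s) (hc t)
    have hlim' := T.tendsto_mul hlim hu1
    rw [T.mul_one] at hlim'
    refine tendsto_nhds_unique (hc (s + t)) (tendsto_of_tendsto_of_tendsto_of_le_of_le hlim' hlim
      (fun n => ?_) (fun n => ?_))
    -- The two floors add up to the floor of the sum or to one less.
    · change T.mul (T.mul (T.pow (u n) (k s n)) (T.pow (u n) (k t n))) (u n) ≤ _
      rw [← T.pow_add]
      refine T.pow_antitone (u n) (show k (s + t) n ≤ k s n + k t n + 1 from ?_)
      have h1 := Nat.lt_floor_add_one (s * 2 ^ n)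
      have h2 := Nat.lt_floor_add_one (t * 2 ^ n)
      apply Nat.le_of_lt_succ
      apply (Nat.floor_lt (by positivity)).2
      simp only [k]
      push_cast
      linarith
    · change _ ≤ T.mul (T.pow (u n) (k s n)) (T.pow (u n) (k t n))
      rw [← T.pow_add]
      refine T.pow_antitone (u n) ?_
      apply Nat.le_floor
      have h1 := Nat.floor_le (show 0 ≤ s * 2 ^ n by positivity)
      have h2 := Nat.floor_le (show 0 ≤ t * 2 ^ n by positivity)
      simp only [k]
      push_cast
      linarith
  have hanti : Antitone c := fun s t hst => iInf_mono fun n =>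
    T.pow_antitone _ (Nat.floor_mono (mul_le_mul_of_nonneg_right hst (by positivity)))
  refine ⟨c, hc0, hadd, hanti, ⟨1 + 1, by norm_num, ?_⟩, fun z hz ε hε => ?_⟩
  · rw [hadd 1 1 zero_le_one zero_le_one, hc1, hpp]
  · have hlim := hT.tendsto_of_mul_self (a := fun n => c ((1 / 2 : ℝ) ^ n))
      (by simpa only [pow_zero, hc1] using hp0) (fun n => by
        rw [← hadd _ _ (by positivity) (by positivity)]
        congr 1
        rw [pow_succ]
        ring)
    have h1 := hlim.eventually (lt_mem_nhds hz)
    have h2 := (tendsto_pow_atTop_nhds_zero_of_lt_one (r := (1 / 2 : ℝ)) (by norm_num)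
      (by norm_num)).eventually (gt_mem_nhds hε)
    obtain ⟨n, hn1, hn2⟩ := (h1.and h2).exists
    exact ⟨_, by positivity, hn2.le, hn1⟩

/-- Every value `x` is attained, at the first time `t` with `c t ≤ x`. If `x < c t`, then still
`x < c t & c δ = c (t + δ)` for small `δ`, so `t` is not the infimum. If `c t < x`, then
`c t < x & c δ ≤ c (t - δ) & c δ = c t` for small `δ`, which is absurd. -/
theorem IsSemigroup.exists_first_eq {c : ℝ → I} (hc : IsSemigroup T c) (x : I) :
    ∃ t, 0 ≤ t ∧ c t = x ∧ ∀ s, 0 ≤ s → s < t → x < c s := by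
  let S : Set ℝ := {t | 0 ≤ t ∧ c t ≤ x}
  have hne : S.Nonempty := by
    obtain ⟨t, ht, h⟩ := hc.exists_eq_zero
    exact ⟨t, ht, h.trans_le unitInterval.nonneg'⟩
  have hbdd : BddBelow S := ⟨0, fun t ht => ht.1⟩
  have ht0 : 0 ≤ sInf S := le_csInf hne fun t ht => ht.1
  have hlt : ∀ s, 0 ≤ s → s < sInf S → x < c s := fun s hs hst => by
    by_contra! h
    exact (csInf_le hbdd ⟨hs, h⟩).not_gt hst
  refine ⟨sInf S, ht0, le_antisymm ?_ ?_, hlt⟩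
  · by_contra! h
    obtain ⟨δ, hδ, -, hδc⟩ := hc.exists_lt (T.imp (c (sInf S)) x)
      (lt_of_le_of_ne unitInterval.le_one' fun h1 => (T.imp_eq_one_iff.1 h1).not_gt h) 1 one_pos
    rw [T.imp_lt_iff, ← hc.add _ _ ht0 hδ.le] at hδc
    have : sInf S + δ ≤ sInf S := le_csInf hne fun t ht => by
      by_contra! h2
      exact ((hc.anti h2.le).trans ht.2).not_gt hδc
    linarith
  · by_contra! h
    have hpos : 0 < sInf S := lt_of_le_of_ne ht0 fun h0 => by
      rw [← h0, hc.zero] at h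
      exact unitInterval.le_one'.not_gt h
    obtain ⟨δ, hδ, hδt, hδc⟩ := hc.exists_lt (T.imp x (c (sInf S)))
      (lt_of_le_of_ne unitInterval.le_one' fun h1 => (T.imp_eq_one_iff.1 h1).not_gt h) _ hpos
    rw [T.imp_lt_iff] at hδc
    have h1 := hc.add (sInf S - δ) δ (by linarith) hδ.le
    rw [sub_add_cancel] at h1
    rw [h1] at hδc
    exact (T.mul_le_mul (hlt _ (by linarith) (by linarith)).le le_rfl).not_gt hδc

theorem IsSemigroup.lt_of_lt (hT : T.IsInvolutive) {c : ℝ → I} (hc : IsSemigroup T c) {s t : ℝ}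
    (hs : 0 ≤ s) (hst : s < t) (h0 : c s ≠ 0) : c t < c s := by
  refine lt_of_le_of_ne (hc.anti hst.le) fun h => ?_
  have hd : 0 < t - s := by linarith
  have h1 := hc.add s (t - s) hs hd.le
  rw [add_sub_cancel, h] at h1
  have h2 := hT.eq_one_of_mul_eq_self h0 h1.symm
  -- A semigroup taking the value `1` at a positive time is constantly `1`.
  have h3 : ∀ n : ℕ, c (n * (t - s)) = 1 := fun n => by
    induction n with
    | zero => rw [Nat.cast_zero, zero_mul, hc.zero]
    | succ n ih =>
      rw [Nat.cast_succ, add_mul, _root_.one_mul, hc.add _ _ (by positivity) hd.le, ih, h2,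
        T.mul_one]
  obtain ⟨r, -, hr⟩ := hc.exists_eq_zero
  obtain ⟨n, hn⟩ := Archimedean.arch r hd
  rw [nsmul_eq_mul] at hn
  have h4 := hc.anti hn
  rw [h3, hr] at h4
  exact zero_lt_one.not_ge h4

/-- If `τ` is the first time at which the semigroup vanishes, `s ↦ c (τ * (1 - s))` is an
isomorphism from the Łukasiewicz t-norm. -/
theorem ContinuousTNorm.IsInvolutive.isomorphic_lukasiewicz (hT : T.IsInvolutive) :
    T.toTNorm.Isomorphic lukasiewicz := by
  obtain ⟨c, hc⟩ := hT.exists_isSemigroup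
  obtain ⟨τ, hτ0, hτ, hlt⟩ := hc.exists_first_eq 0
  have hpos : 0 < τ := lt_of_le_of_ne hτ0 fun h => by
    rw [← h, hc.zero] at hτ
    exact one_ne_zero hτ
  have hvanish : ∀ t, τ ≤ t → c t = 0 := fun t ht =>
    le_antisymm ((hc.anti ht).trans_eq hτ) unitInterval.nonneg'
  let g : I → I := fun s => c (τ * (1 - s))
  have hmono : StrictMono g := fun s t hst => by
    have h1 : (s : ℝ) < t := hst
    have h2 : τ * (1 - t) < τ * (1 - s) := mul_lt_mul_of_pos_left (by linarith) hpos
    have h3 : 0 ≤ τ * (1 - (t : ℝ)) := mul_nonneg hτ0 (by linarith [t.2.2])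
    refine hc.lt_of_lt hT h3 h2 (hlt _ h3 ?_).ne'
    nlinarith [s.2.1]
  have hsurj : Function.Surjective g := fun x => by
    obtain ⟨t, ht0, htx, ht⟩ := hc.exists_first_eq x
    have htτ : t ≤ τ := by
      by_contra! h
      have := ht τ hτ0 h
      rw [hτ] at this
      exact unitInterval.nonneg'.not_gt this
    refine ⟨⟨1 - t / τ, ?_, ?_⟩, ?_⟩
    · rw [sub_nonneg]
      exact (div_le_one hpos).2 htτ
    · have := div_nonneg ht0 hτ0
      linarith
    · change c (τ * (1 - (1 - t / τ))) = x
      rw [← htx]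
      congr 1
      field_simp
      ring
  have hmul : ∀ s t, g (lukasiewicz.mul s t) = T.mul (g s) (g t) := fun s t => by
    have hs : 0 ≤ τ * (1 - (s : ℝ)) := mul_nonneg hτ0 (by linarith [s.2.2])
    have ht : 0 ≤ τ * (1 - (t : ℝ)) := mul_nonneg hτ0 (by linarith [t.2.2])
    change c (τ * (1 - max ((s : ℝ) + t - 1) 0)) = T.mul (c (τ * (1 - s))) (c (τ * (1 - t)))
    rw [← hc.add _ _ hs ht]
    rcases le_total ((s : ℝ) + t - 1) 0 with h | h
    · rw [max_eq_right h, hvanish _ (by linarith), hvanish]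
      nlinarith
    · rw [max_eq_left h]
      congr 1
      ring
  let e : I ≃o I := hmono.orderIsoOfSurjective g hsurj
  have he : ∀ x, g (e.symm x) = x := e.apply_symm_apply
  refine ⟨e.symm, fun x y => ?_⟩
  rw [e.symm_apply_eq]
  change _ = g _
  rw [hmul, he, he]

end RealEnriched

theorem mainTheorem2 (T : RealEnriched.ContinuousTNorm) :
    List.TFAE [
      T.toTNorm.Isomorphic RealEnriched.lukasiewicz,
      ∀ X : RealEnriched.RealCat.{u} T,
        RealEnriched.CompletelyDistributive X → RealEnriched.CompletelyDistributive X.op,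
      RealEnriched.CompletelyDistributive (RealEnriched.V T).op] := by
  tfae_have 1 → 2 := fun h X hX => hX.op (RealEnriched.isInvolutive_of_isomorphic h)
  tfae_have 2 → 3 := by
    intro h
    -- `V` lives in the lowest universe; self-duality is applied to its copy in universe `u`.
    let W : RealEnriched.RealCat.{u} T :=
      { carrier := ULift.{u} I
        hom := fun x y => T.imp x.down y.down
        refl := fun x => T.imp_self x.down
        trans := fun x y z => T.imp_trans x.down y.down z.down }
    have hW : RealEnriched.CompletelyDistributive W :=
      (RealEnriched.completelyDistributive_V T).of_equiv Equiv.ulift.symm fun _ _ => rfl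
    exact (h W hW).of_equiv Equiv.ulift fun _ _ => rfl
  tfae_have 3 → 1 := fun h =>
    (RealEnriched.isInvolutive_of_completelyDistributive_op h).isomorphic_lukasiewicz
  tfae_finish
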